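/- A represented space $\mathbf X=(X,\delta_X)$ is a set $X$ with a partial surjection $\delta_X:\subseteq\{0,1\}^{\mathbb N}\to X$; if $\delta_X(p)=x$, then $p$ is called a name of $x$. A map $f:\mathbf X\to\mathbf Y$ is continuous (computable) if it has a continuous (computable) realizer, i.e. a continuous (Turing machine computable) partial function $F:\subseteq\{0,1\}^{\mathbb N}\to\{0,1\}^{\mathbb N}$ with $\delta_Y(F(p))=f(\delta_X(p))$ for all $p\in\operatorname{dom}\delta_X$. The space $\mathcal C(\mathbf X,\mathbf Y)$ consists of the functions $f:X\to Y$ that have a name, where $0^n1p$ is a name of $f$ if the $n$-th Turing machine with oracle $p$ computes a realizer of $f$. Subsets of a represented space carry the restricted representation. Let $\mathbb S=\{\bot,\top\}$, where $0^{\mathbb N}$ is the only name of $\bot$ and all other sequences are names of $\top$. The space $\mathcal O(\mathbf X)$ of open sets (the space $\mathcal A(\mathbf X)$ of closed sets) is obtained from $\mathcal C(\mathbf X,\mathbb S)$ by identifying $f$ with $f^{-1}(\{\top\})$ (with $f^{-1}(\{\bot\})$). A subset $K\subseteq X$ is compact if for the subspace $\mathbf K$ the map $\mathcal A(\mathbf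 K)\to\mathbb S$ that sends $\emptyset$ to $\top$ and every other set to $\bot$ is continuous, and it is saturated if it is the intersection of all its supersets in $\mathcal O(\mathbf X)$. The space $\mathcal K(\mathbf X)$ consists of the saturated compact sets $K$, each identified with $\{U\in\mathcal O(\mathbf X)\mid K\subseteq U\}\in\mathcal O(\mathcal O(\mathbf X))$. The space $\mathcal V(\mathbf X)$ consists of the closures $\overline A$ of those sets $A\subseteq X$ for which $O_A=\{U\in\mathcal O(\mathbf X)\mid U\cap A\neq\emptyset\}$ is an element of $\mathcal O(\mathcal O(\mathbf X))$, with $\overline A$ identified with $O_A$. Let $\kappa_{\mathbf X}:\mathbf X\to\mathcal O(\mathcal O(\mathbf X))$, $\kappa_{\mathbf X}(x)=\{U\in\mathcal O(\mathbf X)\mid x\in U\}$, and let $\mathbf X_\kappa$ be its image, as a subspace of $\mathcal O(\mathcal O(\mathbf X))$. Call $\mathbf X$ admissible (computably admissible) if $\kappa_{\mathbf X}:\mathbf X\to\mathbf X_\kappa$ has a continuous (computable) left-inverse $\mathbf X_\kappa\to\mathbf X$. **Theorem.** Let $\mathbf X$ and $\mathbf Y$ be represented spaces. If $\mathbf Y$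 is admissible, then so is $\mathcal C(\mathbf X,\mathbf Y)$. If $\mathbf Y$ is computably admissible, then so is $\mathcal C(\mathbf X,\mathbf Y)$. Moreover, the spaces $\mathbf X_\kappa$, $\mathcal O(\mathbf X)$, $\mathcal A(\mathbf X)$, $\mathcal K(\mathbf X)$ and $\mathcal V(\mathbf X)$ are all admissible, and they are all computably admissible. -/

import Mathlib

open Set

universe u v w

/-- Cantor space, with the product topology. -/
abbrev Cantor : Type := ℕ → Bool

namespace Cantor

/-- The finite word consisting of the first `m` symbols of `p`. -/
def take (p : Cantor) (m : ℕ) : List Bool := (List.range m).map p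

/-- The usual pairing `⟨p, q⟩`: `p` on the even places, `q` on the odd places. -/
def pair (p q : Cantor) : Cantor :=
  fun i => if i % 2 = 0 then p (i / 2) else q (i / 2)

/-- The sequence `0ⁿ 1 p`. -/
def tag (n : ℕ) (p : Cantor) : Cantor :=
  fun i => if i < n then false else if i = n then true else p (i - (n + 1))

theorem take_congr {p q : Cantor} {m : ℕ} (h : ∀ i < m, p i = q i) : p.take m = q.take m :=
  List.map_congr_left fun i hi => h i (List.mem_range.1 hi)

theorem take_inj {p q : Cantor} {m : ℕ} (h : p.take m = q.take m) : ∀ i < m, p i = q i := by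
  intro i hi
  have := congrArg (fun l : List Bool => l[i]?) h
  simpa [take, hi] using this

theorem take_getElem? (p : Cantor) {m i : ℕ} (h : i < m) : (p.take m)[i]? = some (p i) := by
  simp [take, h]

theorem tag_inj {n n' : ℕ} {p p' : Cantor} (h : tag n p = tag n' p') : n = n' ∧ p = p' := by
  have key : ∀ {a b : ℕ} {s t : Cantor}, tag a s = tag b t → ¬ a < b := by
    intro a b s t h hab
    have := congrFun h a
    simp [tag, hab] at this
  have hn : n = n' := le_antisymm (not_lt.1 (key h.symm)) (not_lt.1 (key h))
  subst hn
  refine ⟨rfl, funext fun i => ?_⟩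
  have := congrFun h (n + 1 + i)
  have h1 : ¬ n + 1 + i < n := by omega
  have h2 : ¬ n + 1 + i = n := by omega
  have h3 : n + 1 + i - (n + 1) = i := by omega
  simpa only [tag, h1, h2, h3, if_false] using this

end Cantor

/-! ### Machines operating on infinite sequences

The `n`-th machine has its program given by the `n`-th partial recursive code.  In order to produce
the `k`-th symbol of the output it reads its input tape from left to right.  Having read the finite
word `w`, it runs its program on `(w, k)`; the program either asks to read one more symbol
(result `0`), or yields the symbol `0` (result `1`) or the symbol `1` (result `≥ 2`), or diverges.
These machines compute exactly the partial functions on Cantor space that are computable by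
oracle Turing machines (Type-2 Turing machines), with an acceptable numbering. -/

/-- Result of the program of the `n`-th machine for the output place `k`, the word `w` having been
read from the input tape. -/
def machineControl (n : ℕ) (w : List Bool) (k : ℕ) : Part ℕ :=
  (Denumerable.ofNat Nat.Partrec.Code n).eval (Encodable.encode (w, k))

/-- The `k`-th output symbol of the `n`-th machine on input `p`. -/
def machineBit (n : ℕ) (p : Cantor) (k : ℕ) : Part Bool :=
  (Nat.rfind fun m => (machineControl n (p.take m) k).map fun r => decide (r ≠ 0)).bind fun m =>
    (machineControl n (p.take m) k).map fun r => decide (r ≠ 1)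

/-- The partial function on Cantor space computed by the `n`-th machine; it is defined at `p` iff
all output symbols are produced. -/
def machineFun (n : ℕ) : Cantor →. Cantor :=
  fun p => ⟨∀ k, (machineBit n p k).Dom, fun h k => (machineBit n p k).get (h k)⟩

theorem mem_machineFun {n : ℕ} {p q : Cantor} :
    q ∈ machineFun n p ↔ ∀ k, q k ∈ machineBit n p k := by
  constructor
  · rintro ⟨h, rfl⟩ k
    exact Part.get_mem (h k)
  · intro h
    exact ⟨fun k => (h k).1, funext fun k => (h k).2⟩

theorem machineBit_local {n : ℕ} {p : Cantor} {k : ℕ} {b : Bool} (h : b ∈ machineBit n p k) :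
    ∃ M, ∀ p' : Cantor, (∀ i < M, p' i = p i) → b ∈ machineBit n p' k := by
  rw [machineBit, Part.mem_bind_iff] at h
  obtain ⟨m, hm, hb⟩ := h
  refine ⟨m, fun p' hp' => ?_⟩
  have ht : ∀ j, j ≤ m → p'.take j = p.take j := fun j hj =>
    Cantor.take_congr fun i hi => hp' i (by omega)
  rw [machineBit, Part.mem_bind_iff]
  refine ⟨m, ?_, ?_⟩
  · have hm := Nat.mem_rfind.1 hm
    refine Nat.mem_rfind.2 ⟨?_, fun {j} hj => ?_⟩
    · simp only [ht m le_rfl]; exact hm.1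
    · simp only [ht j hj.le]; exact hm.2 hj
  · rw [ht m le_rfl]; exact hb

/-! ### Represented spaces -/

/-- A represented space: a set together with a partial surjection from Cantor space onto it.  The
partial surjection `δ` is given by its graph: `Names p x` means `δ p = x`. -/
structure RepresentedSpace : Type (u + 1) where
  /-- the underlying set -/
  carrier : Type u
  /-- `p` is a name of `x` -/
  Names : Cantor → carrier → Prop
  unique : ∀ {p x y}, Names p x → Names p y → x = y
  surj : ∀ x, ∃ p, Names p x

namespace RepresentedSpace

instance : CoeSort RepresentedSpace.{u} (Type u) := ⟨carrier⟩

/-- The partial function `F` on Cantor space is a realizer of the map `f`. -/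
def Realizes (X : RepresentedSpace.{u}) (Y : RepresentedSpace.{v}) (F : Cantor →. Cantor)
    (f : X → Y) : Prop :=
  ∀ p x, X.Names p x → ∃ q ∈ F p, Y.Names q (f x)

/-- `f` is a continuous map between represented spaces: it has a realizer that is continuous
(on its domain of definition). -/
def IsContinuous (X : RepresentedSpace.{u}) (Y : RepresentedSpace.{v}) (f : X → Y) : Prop :=
  ∃ F : Cantor →. Cantor, Continuous F.asSubtype ∧ Realizes X Y F f

/-- `f` is a computable map between represented spaces: it has a realizer that is computed by a
machine. -/
def IsComputable (X : RepresentedSpace.{u}) (Y : RepresentedSpace.{v}) (f : X → Y) : Prop :=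
  ∃ n : ℕ, Realizes X Y (machineFun n) f

/-- `r` is a name of the function `f : X → Y`: `r = 0ⁿ 1 p`, and the `n`-th machine with oracle `p`
computes a realizer of `f`. -/
def FunName (X : RepresentedSpace.{u}) (Y : RepresentedSpace.{v}) (r : Cantor) (f : X → Y) : Prop :=
  ∃ (n : ℕ) (p : Cantor), r = Cantor.tag n p ∧
    Realizes X Y (fun q => machineFun n (Cantor.pair p q)) f

theorem FunName.unique {X : RepresentedSpace.{u}} {Y : RepresentedSpace.{v}} {r : Cantor}
    {f g : X → Y} (hf : FunName X Y r f) (hg : FunName X Y r g) : f = g := by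
  obtain ⟨n, p, rfl, hf⟩ := hf
  obtain ⟨n', p', h, hg⟩ := hg
  obtain ⟨rfl, rfl⟩ := Cantor.tag_inj h
  funext x
  obtain ⟨q, hq⟩ := X.surj x
  obtain ⟨s, hs, hs'⟩ := hf q x hq
  obtain ⟨t, ht, ht'⟩ := hg q x hq
  obtain rfl := Part.mem_unique hs ht
  exact Y.unique hs' ht'

/-- The space `𝒞(X, Y)` of those functions from `X` to `Y` that have a name. -/
def funSpace (X : RepresentedSpace.{u}) (Y : RepresentedSpace.{v}) :
    RepresentedSpace.{max u v} where
  carrier := {f : X → Y // ∃ r, FunName X Y r f}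
  Names r f := FunName X Y r f.1
  unique hf hg := Subtype.ext (hf.unique hg)
  surj f := f.2

/-! Every continuous map has a name: the oracle is a table of the finite information that a
continuous realizer provides, which is looked up by a fixed machine. -/

def tableLookup (a : List Bool × ℕ) : ℕ :=
  let w := (List.range (Nat.unpair (a.1.length / 2)).1).map fun i => a.1.getD (2 * i + 1) false
  let e := Encodable.encode (w, a.2)
  bif a.1.getD (4 * e + 2) false then (bif a.1.getD (4 * e) false then 2 else 1) else 0

theorem tableLookup_computable : Computable tableLookup := by
  have hlen : Primrec fun a : List Bool × ℕ => (Nat.unpair (a.1.length / 2)).1 :=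
    Primrec.fst.comp (Primrec.unpair.comp
      (Primrec.nat_div.comp (Primrec.list_length.comp Primrec.fst) (Primrec.const 2)))
  have hget : Primrec₂ fun (a : List Bool × ℕ) (i : ℕ) => a.1.getD (2 * i + 1) false :=
    (Primrec.list_getD false).comp (Primrec.fst.comp Primrec.fst)
      (Primrec.succ.comp (Primrec.nat_mul.comp (Primrec.const 2) Primrec.snd))
  have hw := Primrec.list_map (Primrec.list_range.comp hlen) hget
  have he := Primrec.encode.comp (Primrec.pair hw Primrec.snd)
  have h4 := Primrec.nat_mul.comp (Primrec.const 4) he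
  have hb := (Primrec.list_getD false).comp Primrec.fst h4
  have hc := (Primrec.list_getD false).comp Primrec.fst
    (Primrec.nat_add.comp h4 (Primrec.const 2))
  exact (Primrec.cond hc (Primrec.cond hb (Primrec.const 2) (Primrec.const 1))
    (Primrec.const 0)).to_comp

theorem exists_machine_of_total {g : List Bool × ℕ → ℕ} (hg : Computable g) :
    ∃ n, ∀ w k, machineControl n w k = Part.some (g (w, k)) := by
  obtain ⟨c, hc⟩ := Nat.Partrec.Code.exists_code.1 hg
  refine ⟨Encodable.encode c, fun w k => ?_⟩
  rw [machineControl, Denumerable.ofNat_encode, hc]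
  simp

open Classical in
/-- A partial function on Cantor space whose output symbols depend on finite prefixes of the input
only is computed by a machine with a suitable oracle. -/
theorem exists_oracle_machine (F : Cantor →. Cantor)
    (hF : ∀ q, ∀ y ∈ F q, ∀ k, ∃ m, ∀ q', ∀ y' ∈ F q', (∀ i < m, q' i = q i) → y' k = y k) :
    ∃ n o, ∀ q, ∀ y ∈ F q, y ∈ machineFun n (Cantor.pair o q) := by
  let T : ℕ → Bool → Prop := fun e b => ∀ q, ∀ y ∈ F q, ∀ m k,
    e = Encodable.encode (q.take m, k) → y k = b
  let o : Cantor := fun i =>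
    if i % 2 = 0 then decide (T (i / 2) true) else decide (∃ b, T (i / 2) b)
  obtain ⟨n, hn⟩ := exists_machine_of_total tableLookup_computable
  refine ⟨n, o, fun q y hy => mem_machineFun.2 fun k => ?_⟩
  have ho : ∀ e, Cantor.pair o q (4 * e) = decide (T e true) := fun e => by
    have h1 : 4 * e % 2 = 0 := by omega
    have h2 : 4 * e / 2 % 2 = 0 := by omega
    have h3 : 4 * e / 2 / 2 = e := by omega
    simp only [Cantor.pair, o, h1, h2, h3, if_true]
  have ho' : ∀ e, Cantor.pair o q (4 * e + 2) = decide (∃ b, T e b) := fun e => by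
    have h1 : (4 * e + 2) % 2 = 0 := by omega
    have h2 : ¬ (4 * e + 2) / 2 % 2 = 0 := by omega
    have h3 : (4 * e + 2) / 2 / 2 = e := by omega
    simp only [Cantor.pair, o, h1, h2, h3, if_true, if_false]
  have hq : ∀ i, Cantor.pair o q (2 * i + 1) = q i := fun i => by
    have h1 : ¬ (2 * i + 1) % 2 = 0 := by omega
    have h2 : (2 * i + 1) / 2 = i := by omega
    simp only [Cantor.pair, h1, h2, if_false]
  have hlen : ∀ m, ((Cantor.pair o q).take m).length = m := fun m => by simp [Cantor.take]
  have hgetD : ∀ m i, i < m →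
      ((Cantor.pair o q).take m).getD i false = Cantor.pair o q i := fun m i hi => by
    rw [List.getD_eq_getElem?_getD, Cantor.take_getElem? _ hi]; rfl
  have hgetD' : ∀ m i, ¬ i < m → ((Cantor.pair o q).take m).getD i false = false :=
    fun m i hi => by
      rw [List.getD_eq_getElem?_getD, List.getElem?_eq_none (by rw [hlen]; omega)]; rfl
  have hw : ∀ m, ((List.range (Nat.unpair (((Cantor.pair o q).take m).length / 2)).1).map
      fun i => ((Cantor.pair o q).take m).getD (2 * i + 1) false)
      = q.take (Nat.unpair (m / 2)).1 := fun m => by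
    rw [hlen]
    refine List.map_congr_left fun i hi => ?_
    have hi := List.mem_range.1 hi
    have := Nat.unpair_left_le (m / 2)
    rw [hgetD _ _ (by omega), hq]
  -- the result of a lookup
  have hval : ∀ m, tableLookup ((Cantor.pair o q).take m, k) =
      if 4 * Encodable.encode (q.take (Nat.unpair (m / 2)).1, k) + 2 < m ∧
        ∃ b, T (Encodable.encode (q.take (Nat.unpair (m / 2)).1, k)) b
      then (bif y k then 2 else 1) else 0 := by
    intro m
    simp only [tableLookup, hw]
    have hT : ∀ b, T (Encodable.encode (q.take (Nat.unpair (m / 2)).1, k)) b → y k = b :=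
      fun b hb => hb q y hy _ k rfl
    generalize Encodable.encode (q.take (Nat.unpair (m / 2)).1, k) = e at hT
    by_cases he : 4 * e + 2 < m
    · rw [hgetD _ _ he, hgetD _ _ (by omega), ho, ho']
      by_cases hex : ∃ b, T e b
      · obtain ⟨b, hb⟩ := hex
        have hb' := hT b hb
        subst hb'
        have h1 : decide (T e true) = y k := by
          by_cases ht : T e true
          · rw [hT true ht]; simp [ht]
          · have hf : y k = false := by
              by_contra h
              exact ht (Bool.eq_true_of_not_eq_false h ▸ hb)
            rw [hf]; simp [ht]
        rw [if_pos ⟨he, _, hb⟩, decide_eq_true (⟨_, hb⟩ : ∃ b, T e b), h1]; rfl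
      · rw [if_neg (fun h => hex h.2), decide_eq_false hex]; rfl
    · rw [hgetD' _ _ he, if_neg (fun h => he h.1)]; rfl
  -- some lookup is successful
  obtain ⟨j, hj⟩ := hF q y hy k
  have hTj : T (Encodable.encode (q.take j, k)) (y k) := by
    intro q' y' hy' m' k' h
    obtain ⟨hqq, rfl⟩ := Prod.mk.inj (Encodable.encode_injective h)
    have hjm : j = m' := by simpa [Cantor.take] using congrArg List.length hqq
    subst hjm
    exact hj q' y' hy' fun i hi => (Cantor.take_inj hqq i hi).symm
  have hex : ∃ m, tableLookup ((Cantor.pair o q).take m, k) ≠ 0 := by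
    let t := 4 * Encodable.encode (q.take j, k) + 3
    refine ⟨2 * Nat.pair j t, ?_⟩
    have h1 : 2 * Nat.pair j t / 2 = Nat.pair j t := by omega
    have h2 := Nat.right_le_pair j t
    rw [hval, h1, Nat.unpair_pair]
    rw [if_pos ⟨show 4 * Encodable.encode (q.take j, k) + 2 < _ by omega, _, hTj⟩]
    cases y k <;> simp
  rw [machineBit, Part.mem_bind_iff]
  refine ⟨Nat.find hex, Nat.mem_rfind.2 ⟨?_, fun {i} hi => ?_⟩, ?_⟩
  · have := Nat.find_spec hex
    simp [hn, this]
  · have := Nat.find_min hex hi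
    simp only [hn, Part.map_some, Part.mem_some_iff]
    simpa using this
  · have := Nat.find_spec hex
    simp only [hn, Part.map_some, Part.mem_some_iff]
    rw [hval] at this ⊢
    split_ifs at this ⊢ with h
    · cases y k <;> simp
    · exact absurd rfl this

theorem exists_funName {X : RepresentedSpace.{u}} {Y : RepresentedSpace.{v}} {f : X → Y}
    (F : Cantor →. Cantor)
    (hF : ∀ q, ∀ y ∈ F q, ∀ k, ∃ m, ∀ q', ∀ y' ∈ F q', (∀ i < m, q' i = q i) → y' k = y k)
    (hf : Realizes X Y F f) : ∃ r, FunName X Y r f := by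
  obtain ⟨n, o, h⟩ := exists_oracle_machine F hF
  refine ⟨Cantor.tag n o, n, o, rfl, fun p x hp => ?_⟩
  obtain ⟨q, hq, hq'⟩ := hf p x hp
  exact ⟨q, h p q hq, hq'⟩

theorem local_of_continuous {F : Cantor →. Cantor} (hF : Continuous F.asSubtype) :
    ∀ q, ∀ y ∈ F q, ∀ k, ∃ m, ∀ q', ∀ y' ∈ F q', (∀ i < m, q' i = q i) → y' k = y k := by
  intro q y hy k
  obtain ⟨hd, rfl⟩ := hy
  have hc : Continuous fun z : F.Dom => F.asSubtype z k := (continuous_apply k).comp hF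
  have ho : IsOpen ((fun z : F.Dom => F.asSubtype z k) ⁻¹' {(F q).get hd k}) :=
    (isOpen_discrete _).preimage hc
  obtain ⟨U, hU, hUe⟩ := isOpen_induced_iff.1 ho
  have hqU : q ∈ U := by
    have : (⟨q, hd⟩ : F.Dom) ∈ Subtype.val ⁻¹' U := by rw [hUe]; rfl
    exact this
  obtain ⟨I, V, hV, hVU⟩ := isOpen_pi_iff.1 hU q hqU
  refine ⟨I.sup id + 1, fun q' y' hy' hq' => ?_⟩
  obtain ⟨hd', rfl⟩ := hy'
  have hq'U : q' ∈ U := hVU fun i hi => by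
    have hle : i ≤ I.sup id := Finset.le_sup (f := id) hi
    rw [hq' i (by omega)]
    exact (hV i hi).2
  have : (⟨q', hd'⟩ : F.Dom) ∈ Subtype.val ⁻¹' U := hq'U
  rw [hUe] at this
  exact this

/-- Every continuous map is an element of the function space. -/
theorem IsContinuous.exists_funName {X : RepresentedSpace.{u}} {Y : RepresentedSpace.{v}}
    {f : X → Y} (hf : IsContinuous X Y f) : ∃ r, FunName X Y r f := by
  obtain ⟨F, hF, hf⟩ := hf
  exact RepresentedSpace.exists_funName F (local_of_continuous hF) hf

/-- The subspace of `X` given by a subset `s`. -/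
def subspace (X : RepresentedSpace.{u}) (s : Set X) : RepresentedSpace.{u} where
  carrier := s
  Names p x := X.Names p x.1
  unique hx hy := Subtype.ext (X.unique hx hy)
  surj x := X.surj x.1

/-- Sierpiński space `𝕊` (`⊤` is `True`, `⊥` is `False`): `0^ℕ` names `⊥`, all other sequences
name `⊤`. -/
def sierpinski : RepresentedSpace.{0} where
  carrier := Prop
  Names p x := x ↔ p ≠ fun _ => false
  unique hx hy := propext (hx.trans hy.symm)
  surj x := by
    by_cases h : x
    · exact ⟨fun _ => true, iff_of_true h fun h' => by simpa using congrFun h' 0⟩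
    · exact ⟨fun _ => false, iff_of_false h fun h' => h' rfl⟩

/-- The space `𝒪(X)` of open sets: `U` is identified with the function `f : X → 𝕊` such that
`U = f⁻¹({⊤})`. -/
def opens (X : RepresentedSpace.{u}) : RepresentedSpace.{u} where
  carrier := {U : Set X // ∃ r, FunName X sierpinski r (fun x => x ∈ U)}
  Names r U := FunName X sierpinski r (fun x => x ∈ U.1)
  unique hU hV := Subtype.ext (hU.unique hV)
  surj U := U.2

/-- The space `𝒜(X)` of closed sets: `A` is identified with the function `f : X → 𝕊` such that
`A = f⁻¹({⊥})`. -/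
def closeds (X : RepresentedSpace.{u}) : RepresentedSpace.{u} where
  carrier := {A : Set X // ∃ r, FunName X sierpinski r (fun x => x ∉ A)}
  Names r A := FunName X sierpinski r (fun x => x ∉ A.1)
  unique hA hB := Subtype.ext (compl_injective (hA.unique hB))
  surj A := A.2

/-- `X` is compact: the map `𝒜(X) → 𝕊` that decides emptiness is continuous. -/
def IsCompactSpace (X : RepresentedSpace.{u}) : Prop :=
  IsContinuous (closeds X) sierpinski (fun A => A.1 = ∅)

/-- A subset is compact if it is so when equipped with the subspace representation. -/
def IsCompactSet (X : RepresentedSpace.{u}) (K : Set X) : Prop :=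
  IsCompactSpace (subspace X K)

/-- The saturation of `K`: the intersection of all open sets that contain `K`. -/
def saturation (X : RepresentedSpace.{u}) (K : Set X) : Set X :=
  ⋂ U : {U : opens X // K ⊆ U.1}, U.1.1

/-- The closure of `A`: the points all of whose open neighbourhoods intersect `A`. -/
def closure (X : RepresentedSpace.{u}) (A : Set X) : Set X :=
  {x | ∀ U : opens X, x ∈ U.1 → (U.1 ∩ A).Nonempty}

/-- For compact `K`, the set of open supersets of `K` is open in `𝒪(X)`. -/
theorem exists_name_supersets (X : RepresentedSpace.{u}) {K : Set X} (hK : IsCompactSet X K) :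
    ∃ r, FunName (opens X) sierpinski r (fun U => U ∈ {U : opens X | K ⊆ U.1}) := by
  obtain ⟨F, hF, hf⟩ := hK
  refine IsContinuous.exists_funName ⟨F, hF, fun p U hU => ?_⟩
  have hn : FunName (subspace X K) sierpinski p (fun x => x ∉ {x : K | x.1 ∉ U.1}) := by
    obtain ⟨n, o, rfl, h⟩ := hU
    refine ⟨n, o, rfl, fun q x hx => ?_⟩
    obtain ⟨y, hy, hy'⟩ := h q x.1 hx
    refine ⟨y, hy, ?_⟩
    have e : (x ∉ {x : K | x.1 ∉ U.1}) = (x.1 ∈ U.1) := propext not_not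
    exact (congrArg (sierpinski.Names y) e).mpr hy'
  obtain ⟨q, hq, hq'⟩ := hf p ⟨{x : K | x.1 ∉ U.1}, p, hn⟩ hn
  refine ⟨q, hq, ?_⟩
  have : (K ⊆ U.1) = ({x : K | x.1 ∉ U.1} = ∅) := propext
    ⟨fun h => eq_empty_of_forall_notMem fun x hx => hx (h x.2), fun h x hx => by
      by_contra hxU
      exact (h ▸ (show (⟨x, hx⟩ : K) ∈ {x : K | x.1 ∉ U.1} from hxU) : (⟨x, hx⟩ : K) ∈ (∅ : Set K))⟩
  show sierpinski.Names q (K ⊆ U.1)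
  rw [this]
  exact hq'

/-- The space `𝒦(X)` of saturated compact sets: `K` is identified with
`{U ∈ 𝒪(X) | K ⊆ U} ∈ 𝒪(𝒪(X))`. -/
def compacts (X : RepresentedSpace.{u}) : RepresentedSpace.{u} where
  carrier := {K : Set X // IsCompactSet X K ∧ saturation X K = K}
  Names r K := FunName (opens X) sierpinski r (fun U => U ∈ {U : opens X | K.1 ⊆ U.1})
  unique {p K L} hK hL := by
    have h := hK.unique hL
    have h' : ∀ U : opens X, K.1 ⊆ U.1 ↔ L.1 ⊆ U.1 := fun U => iff_of_eq (congrFun h U)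
    apply Subtype.ext
    rw [← K.2.2, ← L.2.2]
    ext x
    simp only [saturation, mem_iInter, Subtype.forall]
    exact forall_congr' fun U => by rw [h' U]
  surj K := exists_name_supersets X K.2.1

theorem inter_closure_nonempty (X : RepresentedSpace.{u}) (A : Set X) (U : opens X) :
    (U.1 ∩ closure X A).Nonempty ↔ (U.1 ∩ A).Nonempty :=
  ⟨fun ⟨_, hx, hx'⟩ => hx' U hx, fun ⟨x, hx, hx'⟩ => ⟨x, hx, fun _ hV => ⟨x, hV, hx'⟩⟩⟩

/-- The space `𝒱(X)` of overt sets: if `A ⊆ X` is such that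
`O_A = {U ∈ 𝒪(X) | U ∩ A ≠ ∅}` is an element of `𝒪(𝒪(X))`, then the closure of `A` is an element of
`𝒱(X)`, and it is identified with `O_A`. -/
def overts (X : RepresentedSpace.{u}) : RepresentedSpace.{u} where
  carrier := {C : Set X // ∃ A : Set X, closure X A = C ∧
    ∃ r, FunName (opens X) sierpinski r (fun U => U ∈ {U : opens X | (U.1 ∩ A).Nonempty})}
  Names r C := FunName (opens X) sierpinski r
    (fun U => U ∈ {U : opens X | (U.1 ∩ C.1).Nonempty})
  unique {p C D} hC hD := by
    have h := hC.unique hD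
    have h' : ∀ U : opens X, (U.1 ∩ C.1).Nonempty ↔ (U.1 ∩ D.1).Nonempty :=
      fun U => iff_of_eq (congrFun h U)
    obtain ⟨C, A, rfl, hA⟩ := C
    obtain ⟨D, B, rfl, hB⟩ := D
    have h'' : ∀ U : opens X, (U.1 ∩ A).Nonempty ↔ (U.1 ∩ B).Nonempty := fun U =>
      (inter_closure_nonempty X A U).symm.trans ((h' U).trans (inter_closure_nonempty X B U))
    apply Subtype.ext
    ext x
    exact forall_congr' fun U => by rw [h'' U]
  surj C := by
    obtain ⟨C, A, rfl, hA⟩ := C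
    have e : {U : opens X | (U.1 ∩ closure X A).Nonempty} = {U : opens X | (U.1 ∩ A).Nonempty} :=
      Set.ext fun U => inter_closure_nonempty X A U
    show ∃ r, FunName (opens X) sierpinski r
      (fun U => U ∈ {U : opens X | (U.1 ∩ closure X A).Nonempty})
    rw [e]
    exact hA

/-! ### The map `κ` and admissibility -/

/-- For every point `x`, the set of open neighbourhoods of `x` is open in `𝒪(X)`. -/
theorem exists_name_nhds (X : RepresentedSpace.{u}) (x : X) :
    ∃ r, FunName (opens X) sierpinski r (fun U => U ∈ {U : opens X | x ∈ U.1}) := by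
  classical
  obtain ⟨q, hq⟩ := X.surj x
  let R : Cantor → Cantor → Prop := fun r y =>
    ∃ n p, r = Cantor.tag n p ∧ y ∈ machineFun n (Cantor.pair p q)
  let F : Cantor →. Cantor := fun r => ⟨∃ y, R r y, fun h => h.choose⟩
  have hmem : ∀ {r y}, R r y → y ∈ F r := fun {r y} h => by
    have h0 : ∃ y, R r y := ⟨y, h⟩
    refine ⟨h0, ?_⟩
    obtain ⟨n, p, rfl, hy⟩ := h
    obtain ⟨n', p', e, hy'⟩ := h0.choose_spec
    obtain ⟨rfl, rfl⟩ := Cantor.tag_inj e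
    exact Part.mem_unique hy' hy
  have hmem' : ∀ {r y}, y ∈ F r → R r y := fun {r y} h => by
    obtain ⟨h0, rfl⟩ := h
    exact h0.choose_spec
  refine exists_funName F ?_ ?_
  · intro r y hy k
    obtain ⟨n, p, rfl, hz⟩ := hmem' hy
    obtain ⟨M, hM⟩ := machineBit_local (mem_machineFun.1 hz k)
    refine ⟨n + 1 + M, fun r' y' hy' hr => ?_⟩
    obtain ⟨n', p', rfl, hz'⟩ := hmem' hy'
    have hn : n' = n := by
      have h1 := hr n (by omega)
      by_contra hne
      rcases lt_or_gt_of_ne hne with hlt | hgt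
      · have h2 := hr n' (by omega)
        simp [Cantor.tag, hlt] at h2
      · simp [Cantor.tag, hgt] at h1
    subst hn
    have hp : ∀ i < M, p' i = p i := fun i hi => by
      have := hr (n' + 1 + i) (by omega)
      have h1 : ¬ n' + 1 + i < n' := by omega
      have h2 : ¬ n' + 1 + i = n' := by omega
      have h3 : n' + 1 + i - (n' + 1) = i := by omega
      simpa only [Cantor.tag, h1, h2, h3, if_false] using this
    refine Part.mem_unique (mem_machineFun.1 hz' k) (hM _ fun i hi => ?_)
    simp only [Cantor.pair]
    split_ifs
    · exact hp _ (by omega)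
    · rfl
  · rintro r U ⟨n, p, rfl, h⟩
    obtain ⟨y, hy, hy'⟩ := h q x hq
    exact ⟨y, hmem ⟨n, p, rfl, hy⟩, hy'⟩

/-- The map `κ : X → 𝒪(𝒪(X))`, `κ(x) = {U ∈ 𝒪(X) | x ∈ U}`. -/
def kappa (X : RepresentedSpace.{u}) (x : X) : opens (opens X) :=
  ⟨{U : opens X | x ∈ U.1}, exists_name_nhds X x⟩

/-- The space `X_κ`: the image of `X` under `κ`, as a subspace of `𝒪(𝒪(X))`. -/
def kappaSpace (X : RepresentedSpace.{u}) : RepresentedSpace.{u} :=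
  subspace (opens (opens X)) (Set.range (kappa X))

/-- The map `κ` as a map from `X` to `X_κ`. -/
def toKappaSpace (X : RepresentedSpace.{u}) (x : X) : kappaSpace X :=
  ⟨kappa X x, x, rfl⟩

/-- `X` is admissible: `κ : X → X_κ` has a continuous left-inverse. -/
def IsAdmissible (X : RepresentedSpace.{u}) : Prop :=
  ∃ g : kappaSpace X → X, IsContinuous (kappaSpace X) X g ∧
    Function.LeftInverse g (toKappaSpace X)

/-- `X` is computably admissible: `κ : X → X_κ` has a computable left-inverse. -/
def IsComputablyAdmissible (X : RepresentedSpace.{u}) : Prop :=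
  ∃ g : kappaSpace X → X, IsComputable (kappaSpace X) X g ∧
    Function.LeftInverse g (toKappaSpace X)

end RepresentedSpace

open Filter

/-! Everything rests on computing with points through evaluation of open sets. For `𝒪(X)`: a point
`x` yields `κ(x) ∈ 𝒪(𝒪(X))`, and `U ∈ κ(x)` iff `x ∈ U`. Given `κ(U) ∈ 𝒪(𝒪(𝒪(X)))`, testing whether
it contains `κ(x)` therefore semidecides `x ∈ U`; currying in `x` recovers a name of `U`. So `𝒪(X)`
is computably admissible for every `X` (`opens_isComputablyAdmissible`). The other hyperspaces and
`X_κ` have exactly the names of certain points of `𝒪(X)` or `𝒪(𝒪(X))`, and computable admissibility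
passes to such embedded spaces, because preimages of open sets keep their names
(`isComputablyAdmissible_of_embedding`). For `𝒞(X, Y)`: from `κ(f)` and `x` one obtains `κ(f x)`,
since `f x ∈ V` iff `{g | g x ∈ V}` belongs to `κ(f)`, and this open set of functions is computable
from `x` and `V`. The left-inverse of `κ` on `Y` then gives `f x`, and currying gives `f`
(`funSpace_comp`).

The arguments need only composition, pairing, currying and evaluation of computable maps. These are
established for `Comp`, computability by primitive recursive functions on finite words: such
functions are total, so composing them involves no halting conditions, and cutting off a machine
after as many steps as the word is long makes every machine an instance (`tracks_machineWord`, with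
converse `exists_machine_of_tracks`). Continuity is treated as computability relative to a fixed
oracle, carried along as one more parameter. -/

/-! ### Word functions tracking partial functions on Cantor space -/

/-- The word function `h` sends the prefixes of `p` to prefixes of `q` of unbounded length. -/
def Tracks (h : List Bool → List Bool) (p q : Cantor) : Prop :=
  (∀ m k b, (h (p.take m))[k]? = some b → b = q k) ∧
    ∀ k, ∀ᶠ m in atTop, k < (h (p.take m)).length

/-! ### Prefixes, pairs and tags of sequences. -/

namespace Cantor

@[simp] theorem length_take (p : Cantor) (m : ℕ) : (p.take m).length = m := by simp [take]

theorem getElem?_take_eq_some {p : Cantor} {m k : ℕ} {b : Bool} (h : (p.take m)[k]? = some b) :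
    k < m ∧ b = p k := by
  by_cases hk : k < m
  · rw [take_getElem? _ hk] at h
    exact ⟨hk, (Option.some.inj h).symm⟩
  · rw [List.getElem?_eq_none (by simpa using hk)] at h
    cases h

theorem list_take_take (p : Cantor) {i m : ℕ} (h : i ≤ m) : (p.take m).take i = p.take i := by
  simp [take, ← List.map_take, List.take_range, min_eq_left h]

theorem pair_even (p q : Cantor) (k : ℕ) : pair p q (2 * k) = p k := by
  have h1 : 2 * k % 2 = 0 := by omega
  have h2 : 2 * k / 2 = k := by omega
  simp only [pair, h1, h2, if_true]

theorem pair_odd (p q : Cantor) (k : ℕ) : pair p q (2 * k + 1) = q k := by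
  have h1 : ¬ (2 * k + 1) % 2 = 0 := by omega
  have h2 : (2 * k + 1) / 2 = k := by omega
  simp only [pair, h1, h2, if_false]

theorem pair_inj {p q p' q' : Cantor} (h : pair p q = pair p' q') : p = p' ∧ q = q' :=
  ⟨funext fun k => by rw [← pair_even p q, h, pair_even],
    funext fun k => by rw [← pair_odd p q, h, pair_odd]⟩

theorem tag_lt {n k : ℕ} (p : Cantor) (h : k < n) : tag n p k = false := by simp [tag, h]

theorem tag_self (n : ℕ) (p : Cantor) : tag n p n = true := by simp [tag]

theorem tag_add (n k : ℕ) (p : Cantor) : tag n p (n + 1 + k) = p k := by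
  have h1 : ¬ n + 1 + k < n := by omega
  have h2 : ¬ n + 1 + k = n := by omega
  have h3 : n + 1 + k - (n + 1) = k := by omega
  simp only [tag, h1, h2, h3, if_false]

end Cantor

/-! ### Calculus of tracking word functions. -/

namespace Tracks

theorem getElem?_eventually {h : List Bool → List Bool} {p q : Cantor} (H : Tracks h p q) (k : ℕ) :
    ∀ᶠ m in atTop, (h (p.take m))[k]? = some (q k) := by
  filter_upwards [H.2 k] with m hm
  have := List.getElem?_eq_getElem hm
  rw [this, H.1 m k _ this]

theorem apply_take {h : List Bool → List Bool} {p q : Cantor} (H : Tracks h p q) (m : ℕ) :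
    h (p.take m) = q.take (h (p.take m)).length := by
  refine List.ext_getElem? fun k => ?_
  by_cases hk : k < (h (p.take m)).length
  · have := List.getElem?_eq_getElem hk
    rw [Cantor.take_getElem? _ hk, this, H.1 m k _ this]
  · rw [List.getElem?_eq_none (by omega), List.getElem?_eq_none (by simpa using hk)]

theorem tendsto_length {h : List Bool → List Bool} {p q : Cantor} (H : Tracks h p q) :
    Tendsto (fun m => (h (p.take m)).length) atTop atTop :=
  tendsto_atTop.2 fun k => (H.2 k).mono fun _ hm => hm.le

theorem id (p : Cantor) : Tracks id p p :=
  ⟨fun _ _ _ h => (Cantor.getElem?_take_eq_some h).2, fun k => by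
    simpa using eventually_gt_atTop k⟩

/-- On prefixes of `p` the values of `h` are themselves prefixes of `q`, with lengths tending to
infinity, so the conditions on `g` transfer along this limit. Monotonicity of the word functions is
never needed. -/
theorem comp {g h : List Bool → List Bool} {p q r : Cantor} (hg : Tracks g q r)
    (hh : Tracks h p q) : Tracks (g ∘ h) p r := by
  constructor
  · intro m k b hb
    rw [Function.comp_apply, hh.apply_take] at hb
    exact hg.1 _ _ _ hb
  · intro k
    filter_upwards [hh.tendsto_length.eventually (hg.2 k)] with m hm
    rw [Function.comp_apply, hh.apply_take]
    exact hm

/-- Allows a word function to stay silent until the prefix contains enough information to proceed.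
-/
theorem of_eventually {g h : List Bool → List Bool} {p q : Cantor} (hg : Tracks g p q)
    (h1 : ∀ m, h (p.take m) = [] ∨ h (p.take m) = g (p.take m))
    (h2 : ∀ᶠ m in atTop, h (p.take m) = g (p.take m)) : Tracks h p q := by
  constructor
  · intro m k b hb
    rcases h1 m with e | e
    · simp [e] at hb
    · exact hg.1 m k b (e ▸ hb)
  · intro k
    filter_upwards [h2, hg.2 k] with m e hm
    rwa [e]

end Tracks

/-- The longest word that is determined by the partial symbols `b w 0`, `b w 1`, … and that is not
longer than `w`. -/
def collect (b : List Bool → ℕ → Option Bool) (w : List Bool) : List Bool :=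
  (List.range ((List.range w.length).findIdx fun k => (b w k).isNone)).map
    fun k => (b w k).getD false

theorem collect_primrec {α : Type*} [Primcodable α] {b : α → List Bool → ℕ → Option Bool}
    (hb : Primrec fun x : (α × List Bool) × ℕ => b x.1.1 x.1.2 x.2) :
    Primrec₂ fun (a : α) (w : List Bool) => collect (b a) w := by
  have h1 : Primrec fun x : (α × List Bool) × ℕ => (b x.1.1 x.1.2 x.2).isNone :=
    (Primrec.not.comp (Primrec.option_isSome.comp hb)).of_eq fun x => by simp
  have h2 : Primrec₂ fun (x : α × List Bool) (k : ℕ) => (b x.1 x.2 k).getD false :=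
    (Primrec.option_getD.comp hb (Primrec.const false)).to₂
  exact (Primrec.list_map (Primrec.list_range.comp (Primrec.list_findIdx
    (Primrec.list_range.comp (Primrec.list_length.comp Primrec.snd)) h1.to₂)) h2).to₂

/-- The output stops at the first undetermined symbol, so it is correct as soon as the single
symbols are; it grows because finitely many symbols are eventually all determined at once. -/
theorem tracks_collect {b : List Bool → ℕ → Option Bool} {p q : Cantor}
    (h1 : ∀ m k c, b (p.take m) k = some c → c = q k)
    (h2 : ∀ k, ∀ᶠ m in atTop, (b (p.take m) k).isSome) : Tracks (collect b) p q := by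
  constructor
  · intro m k c hc
    simp only [collect] at hc
    set j := (List.range (p.take m).length).findIdx fun k => (b (p.take m) k).isNone with hj
    by_cases hk : k < j
    · rw [List.getElem?_map, List.getElem?_range hk] at hc
      have hn := List.not_of_lt_findIdx (hj ▸ hk)
      rw [List.getElem_range] at hn
      obtain ⟨d, hd⟩ := Option.isSome_iff_exists.1 (by simpa using hn : (b (p.take m) k).isSome)
      have : d = c := by simpa [hd] using hc
      exact this ▸ h1 m k d hd
    · rw [List.getElem?_eq_none (by simpa using hk)] at hc
      cases hc
  · intro k
    have : ∀ᶠ m in atTop, ∀ i ∈ Finset.range (k + 1), (b (p.take m) i).isSome :=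
      (Finset.eventually_all _).2 fun i _ => h2 i
    filter_upwards [this, eventually_gt_atTop k] with m hm hkm
    simp only [collect, List.length_map, List.length_range]
    by_contra hlt
    push Not at hlt
    set l := List.range (p.take m).length with hl
    have hlen : l.length = m := by simp [hl]
    have hlt' : l.findIdx (fun k => (b (p.take m) k).isNone) < l.length := by omega
    have h3 := List.findIdx_getElem (w := hlt')
    simp only [hl, List.getElem_range] at h3
    have h4 := hm _ (Finset.mem_range.2 (Nat.lt_succ_of_le hlt))
    rw [Option.isNone_iff_eq_none] at h3
    rw [hl, h3] at h4
    cases h4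

/-! ### Machines and word functions -/

/-- A function tracked by a primitive recursive word function is computed by a machine. -/
theorem exists_machine_of_tracks {h : List Bool → List Bool} (hh : Primrec h) :
    ∃ n, ∀ p q, Tracks h p q → q ∈ machineFun n p := by
  -- The answers of a machine program: 0 asks for more input, 1 and 2 output the symbols 0 and 1.
  let g : List Bool × ℕ → ℕ := fun a =>
    Option.casesOn (h a.1)[a.2]? 0 fun b => bif b then 2 else 1
  have hg : Primrec g := Primrec.option_casesOn
    (Primrec.list_getElem?.comp (hh.comp Primrec.fst) Primrec.snd) (Primrec.const 0)
    (Primrec.cond Primrec.snd (Primrec.const 2) (Primrec.const 1)).to₂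
  obtain ⟨n, hn⟩ := RepresentedSpace.exists_machine_of_total hg.to_comp
  refine ⟨n, fun p q H => mem_machineFun.2 fun k => ?_⟩
  have hval : ∀ m, g (p.take m, k) ≠ 0 → g (p.take m, k) = bif q k then 2 else 1 := by
    intro m hm
    simp only [g] at hm ⊢
    cases hb : (h (p.take m))[k]? with
    | none => simp [hb] at hm
    | some b => rw [H.1 m k b hb]
  have hex : ∃ m, g (p.take m, k) ≠ 0 := by
    obtain ⟨m, hm⟩ := (H.getElem?_eventually k).exists
    refine ⟨m, ?_⟩
    simp only [g, hm]
    cases q k <;> simp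
  obtain ⟨m, hm, hmin⟩ : ∃ m, g (p.take m, k) ≠ 0 ∧ ∀ i < m, ¬ g (p.take i, k) ≠ 0 := by
    classical exact ⟨Nat.find hex, Nat.find_spec hex, fun _ => Nat.find_min hex⟩
  rw [machineBit, Part.mem_bind_iff]
  refine ⟨m, Nat.mem_rfind.2 ⟨?_, fun {i} hi => ?_⟩, ?_⟩
  · simp [hn, hm]
  · have := hmin i hi
    simp only [hn, Part.map_some, Part.mem_some_iff]
    simpa using this
  · have := hval m hm
    simp only [hn, Part.map_some, Part.mem_some_iff, this]
    cases q k <;> simp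

/-- The result of the program of the `n`-th machine within `t` steps. -/
def machineControlStep (n t : ℕ) (w : List Bool) (k : ℕ) : Option ℕ :=
  Nat.Partrec.Code.evaln t (Denumerable.ofNat Nat.Partrec.Code n) (Encodable.encode (w, k))

/-- The `k`-th output symbol of the `n`-th machine, as far as it is found by `|w|` steps of each
computation on the prefixes of `w`. -/
def machineBitStep (n : ℕ) (w : List Bool) (k : ℕ) : Option Bool :=
  (machineControlStep n w.length (w.take ((List.range (w.length + 1)).findIdx fun m =>
    !decide (machineControlStep n w.length (w.take m) k = some 0))) k).bind fun r =>
      bif decide (r = 0) then none else some (!decide (r = 1))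

theorem machineControlStep_primrec :
    Primrec fun x : (ℕ × ℕ) × (List Bool × ℕ) => machineControlStep x.1.1 x.1.2 x.2.1 x.2.2 :=
  Nat.Partrec.Code.primrec_evaln.comp (Primrec.pair (Primrec.pair (Primrec.snd.comp Primrec.fst)
    ((Primrec.ofNat Nat.Partrec.Code).comp (Primrec.fst.comp Primrec.fst)))
    (Primrec.encode.comp Primrec.snd))

theorem machineBitStep_primrec :
    Primrec fun x : (ℕ × List Bool) × ℕ => machineBitStep x.1.1 x.1.2 x.2 := by
  have hn : Primrec fun x : (ℕ × List Bool) × ℕ => x.1.1 := Primrec.fst.comp Primrec.fst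
  have hw : Primrec fun x : (ℕ × List Bool) × ℕ => x.1.2 := Primrec.snd.comp Primrec.fst
  have hl := Primrec.list_length.comp hw
  have hk : Primrec fun x : (ℕ × List Bool) × ℕ => x.2 := Primrec.snd
  have h1 : Primrec₂ fun (x : (ℕ × List Bool) × ℕ) (m : ℕ) =>
      !decide (machineControlStep x.1.1 x.1.2.length (x.1.2.take m) x.2 = some 0) :=
    Primrec.not.comp (Primrec.eq.decide.comp (machineControlStep_primrec.comp
      (Primrec.pair (Primrec.pair (hn.comp Primrec.fst) (hl.comp Primrec.fst))
        (Primrec.pair (Primrec.list_take.comp Primrec.snd (hw.comp Primrec.fst))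
          (hk.comp Primrec.fst)))) (Primrec.const (some 0)))
  have h2 := Primrec.list_findIdx (Primrec.list_range.comp (Primrec.succ.comp hl)) h1
  have h3 := machineControlStep_primrec.comp
      (Primrec.pair (Primrec.pair hn hl) (Primrec.pair (Primrec.list_take.comp h2 hw) hk))
  refine Primrec.option_bind h3 (Primrec.cond (Primrec.eq.decide.comp Primrec.snd (Primrec.const 0))
    (Primrec.const none) (Primrec.option_some.comp
      (Primrec.not.comp (Primrec.eq.decide.comp Primrec.snd (Primrec.const 1))))).to₂

/-- The word function obtained by running the `n`-th machine. -/
def machineWord (n : ℕ) (w : List Bool) : List Bool := collect (machineBitStep n) w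

theorem machineWord_primrec : Primrec₂ machineWord := collect_primrec machineBitStep_primrec

theorem machineControlStep_sound {n t : ℕ} {w : List Bool} {k r : ℕ}
    (h : machineControlStep n t w k = some r) : r ∈ machineControl n w k :=
  Nat.Partrec.Code.evaln_sound h

theorem machineControlStep_eventually {n : ℕ} {w : List Bool} {k r : ℕ}
    (h : r ∈ machineControl n w k) : ∀ᶠ t in atTop, machineControlStep n t w k = some r := by
  obtain ⟨t, ht⟩ := Nat.Partrec.Code.evaln_complete.1 h
  filter_upwards [eventually_ge_atTop t] with s hs
  exact Nat.Partrec.Code.evaln_mono hs ht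

theorem machineControl_of_mem_machineBit {n : ℕ} {p : Cantor} {k : ℕ} {b : Bool}
    (h : b ∈ machineBit n p k) :
    ∃ m r, r ∈ machineControl n (p.take m) k ∧ r ≠ 0 ∧ b = decide (r ≠ 1) ∧
      ∀ i < m, 0 ∈ machineControl n (p.take i) k := by
  rw [machineBit, Part.mem_bind_iff] at h
  obtain ⟨m, hm, hb⟩ := h
  obtain ⟨hm1, hm2⟩ := Nat.mem_rfind.1 hm
  obtain ⟨r, hr, hrb⟩ := (Part.mem_map_iff _).1 hb
  obtain ⟨r', hr', hrb'⟩ := (Part.mem_map_iff _).1 hm1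
  obtain rfl := Part.mem_unique hr hr'
  refine ⟨m, r, hr, by simpa using hrb', hrb.symm, fun i hi => ?_⟩
  obtain ⟨s, hs, hs'⟩ := (Part.mem_map_iff _).1 (hm2 hi)
  have : s = 0 := by simpa using hs'
  exact this ▸ hs

/-- The search with time bound `t` stops at the first prefix whose answer within `t` steps is not 0.
If it stops because the time ran out, no symbol is produced. Otherwise all shorter prefixes have
truly answered 0, so it is the place where the machine itself stops. That place is found for all
large `t`, as only finitely many computations are involved. -/
theorem tracks_machineWord {n : ℕ} {p q : Cantor} (h : q ∈ machineFun n p) :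
    Tracks (machineWord n) p q := by
  refine tracks_collect (fun t k c hc => ?_) fun k => ?_ <;>
    obtain ⟨m, r, hr, hr0, hq, hi⟩ := machineControl_of_mem_machineBit (mem_machineFun.1 h k)
  · simp only [machineBitStep, Cantor.length_take] at hc
    set j := (List.range (t + 1)).findIdx fun m =>
      !decide (machineControlStep n t ((p.take t).take m) k = some 0) with hj
    obtain ⟨s, hs, hsc⟩ := Option.bind_eq_some_iff.1 hc
    have hs0 : s ≠ 0 := by rintro rfl; simp at hsc
    have hsc' : (!decide (s = 1)) = c := by simpa [hs0] using hsc
    -- If all prefixes answer 0, the search returns its length `t + 1`; truncating at that index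
    -- gives the whole word, whose answer is again 0, so no symbol results.
    have hjt : j ≤ t := by
      by_contra hjt
      have hj' : j = t + 1 := by
        have := List.findIdx_le_length (xs := List.range (t + 1)) (p := fun m =>
          !decide (machineControlStep n t ((p.take t).take m) k = some 0))
        rw [List.length_range, ← hj] at this
        omega
      have h5 := List.not_of_lt_findIdx (show t < _ by rw [← hj]; omega)
      simp only [List.getElem_range] at h5
      have h5 : machineControlStep n t ((p.take t).take t) k = some 0 := by simpa using h5
      have h6 : (p.take t).take j = (p.take t).take t := by
        rw [List.take_of_length_le (by simp; omega), List.take_of_length_le (by simp)]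
      rw [h6, h5] at hs
      exact hs0 (Option.some.inj hs).symm
    rw [Cantor.list_take_take _ hjt] at hs
    -- Stopping before `m` contradicts the true answer 0 there; passing over `m` would need the
    -- answer 0 at `m`, where the true answer is `r ≠ 0`.
    have hjm : j = m := by
      rcases lt_trichotomy j m with hlt | heq | hgt
      · exact absurd (Part.mem_unique (machineControlStep_sound hs) (hi j hlt)) hs0
      · exact heq
      · have h5 := List.not_of_lt_findIdx (hj ▸ hgt)
        simp only [List.getElem_range] at h5
        rw [Cantor.list_take_take _ (by omega)] at h5
        have h5 : machineControlStep n t (p.take m) k = some 0 := by simpa using h5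
        exact absurd (Part.mem_unique hr (machineControlStep_sound h5)) hr0
    rw [hjm] at hs
    obtain rfl := Part.mem_unique hr (machineControlStep_sound hs)
    rw [hq, ← hsc']
    simp
  · have h1 : ∀ᶠ t in atTop, ∀ i ∈ Finset.range m, machineControlStep n t (p.take i) k = some 0 :=
      (Finset.eventually_all _).2 fun i hi' =>
        machineControlStep_eventually (hi i (Finset.mem_range.1 hi'))
    filter_upwards [h1, machineControlStep_eventually hr, eventually_ge_atTop m] with t ht htr htm
    simp only [machineBitStep, Cantor.length_take]
    have hj : (List.range (t + 1)).findIdx (fun m =>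
        !decide (machineControlStep n t ((p.take t).take m) k = some 0)) = m := by
      have hlt : m < (List.range (t + 1)).length := by simp; omega
      rw [List.findIdx_eq hlt]
      simp only [List.getElem_range, Cantor.list_take_take _ htm, htr]
      refine ⟨by simpa using hr0, fun i hi' => ?_⟩
      rw [Cantor.list_take_take _ (by omega), ht i (Finset.mem_range.2 hi')]
      simp
    rw [hj, Cantor.list_take_take _ htm, htr]
    simp [hr0]

/-! ### Pairing, tagging and the universal machine on words -/

theorem exists_tracks_fst : ∃ h, Primrec h ∧ ∀ p q, Tracks h (Cantor.pair p q) p := by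
  refine ⟨fun w => collect (fun w k => w[2 * k]?) w, ?_, fun p q => tracks_collect ?_ ?_⟩
  · exact (collect_primrec (α := Unit) (b := fun _ w k => w[2 * k]?)
      (Primrec.list_getElem?.comp (Primrec.snd.comp Primrec.fst)
        (Primrec.nat_double.comp Primrec.snd))).comp (Primrec.const ()) Primrec.id
  · intro m k c hc
    rw [(Cantor.getElem?_take_eq_some hc).2, Cantor.pair_even]
  · intro k
    filter_upwards [eventually_gt_atTop (2 * k)] with m hm
    simp [Cantor.take_getElem? _ hm]

theorem exists_tracks_snd : ∃ h, Primrec h ∧ ∀ p q, Tracks h (Cantor.pair p q) q := by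
  refine ⟨fun w => collect (fun w k => w[2 * k + 1]?) w, ?_, fun p q => tracks_collect ?_ ?_⟩
  · exact (collect_primrec (α := Unit) (b := fun _ w k => w[2 * k + 1]?)
      (Primrec.list_getElem?.comp (Primrec.snd.comp Primrec.fst)
        (Primrec.nat_double_succ.comp Primrec.snd))).comp (Primrec.const ()) Primrec.id
  · intro m k c hc
    rw [(Cantor.getElem?_take_eq_some hc).2, Cantor.pair_odd]
  · intro k
    filter_upwards [eventually_gt_atTop (2 * k + 1)] with m hm
    simp [Cantor.take_getElem? _ hm]

theorem exists_tracks_pair {g h : List Bool → List Bool} (hg : Primrec g) (hh : Primrec h) :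
    ∃ f, Primrec f ∧ ∀ p q r, Tracks g p q → Tracks h p r → Tracks f p (Cantor.pair q r) := by
  refine ⟨fun w => collect (fun w k => if k % 2 = 0 then (g w)[k / 2]? else (h w)[k / 2]?) w, ?_,
    fun p q r hq hr => tracks_collect ?_ ?_⟩
  · have hk := Primrec.nat_div.comp (Primrec.snd (α := Unit × List Bool)) (Primrec.const 2)
    refine (collect_primrec (α := Unit)
      (b := fun _ w k => if k % 2 = 0 then (g w)[k / 2]? else (h w)[k / 2]?)
      (Primrec.ite (Primrec.eq.comp (Primrec.nat_mod.comp Primrec.snd (Primrec.const 2))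
        (Primrec.const 0)) ?_ ?_)).comp (Primrec.const ()) Primrec.id
    · exact Primrec.list_getElem?.comp (hg.comp (Primrec.snd.comp Primrec.fst)) hk
    · exact Primrec.list_getElem?.comp (hh.comp (Primrec.snd.comp Primrec.fst)) hk
  · intro m k c hc
    simp only [Cantor.pair] at hc ⊢
    split_ifs at hc ⊢
    · exact hq.1 _ _ _ hc
    · exact hr.1 _ _ _ hc
  · intro k
    filter_upwards [hq.getElem?_eventually (k / 2), hr.getElem?_eventually (k / 2)] with m h1 h2
    simp only [h1, h2]
    split_ifs <;> rfl

theorem exists_tracks_tag (n : ℕ) : ∃ h, Primrec h ∧ ∀ p, Tracks h p (Cantor.tag n p) := by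
  refine ⟨fun w => (List.replicate n false ++ [true]) ++ w,
    Primrec.list_append.comp (Primrec.const _) Primrec.id, fun p => ⟨fun m k b hb => ?_, ?_⟩⟩
  · beta_reduce at hb
    rcases lt_trichotomy k n with hk | rfl | hk
    · rw [Cantor.tag_lt _ hk]
      rw [List.append_assoc, List.getElem?_append_left (by simpa using hk)] at hb
      simpa [List.getElem?_replicate, hk] using hb.symm
    · rw [Cantor.tag_self]
      simpa using hb.symm
    · obtain ⟨i, rfl⟩ := Nat.exists_eq_add_of_lt hk
      rw [List.getElem?_append_right (by simp)] at hb
      rw [show n + i + 1 = n + 1 + i by omega, Cantor.tag_add]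
      have e : n + i + 1 - (List.replicate n false ++ [true]).length = i := by simp
      rw [e] at hb
      exact (Cantor.getElem?_take_eq_some hb).2
  · intro k
    filter_upwards [eventually_gt_atTop k] with m hm
    simp
    omega

/-- The universal machine. -/
theorem exists_tracks_universal : ∃ h, Primrec h ∧ ∀ n p q y,
    y ∈ machineFun n (Cantor.pair p q) → Tracks h (Cantor.pair (Cantor.tag n p) q) y := by
  -- The even places of `u` carry `0ⁿ 1 p`, so the first 1 among them is the index `n`. Places
  -- beyond the end of `u` count as 0; an unsuccessful search returns `u.length`, where the test
  -- below reads the default 0.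
  let idx : List Bool → ℕ := fun u =>
    (List.range u.length).findIdx fun i => u.getD (2 * i) false
  -- Turns `⟨0ⁿ 1 p, q⟩` into `⟨p, q⟩`: the even places skip the tag of length `n + 1`, the odd
  -- places stay.
  let input : ℕ → List Bool → ℕ → Option Bool := fun n u k =>
    if k % 2 = 0 then u[2 * (n + 1 + k / 2)]? else u[k]?
  have hidx : Primrec idx := Primrec.list_findIdx (Primrec.list_range.comp Primrec.list_length)
    ((Primrec.list_getD false).comp Primrec.fst (Primrec.nat_double.comp Primrec.snd)).to₂
  have hinput : Primrec fun x : (ℕ × List Bool) × ℕ => input x.1.1 x.1.2 x.2 :=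
    Primrec.ite (Primrec.eq.comp (Primrec.nat_mod.comp Primrec.snd (Primrec.const 2))
        (Primrec.const 0))
      (Primrec.list_getElem?.comp (Primrec.snd.comp Primrec.fst) (Primrec.nat_double.comp
        (Primrec.nat_add.comp (Primrec.succ.comp (Primrec.fst.comp Primrec.fst))
          (Primrec.nat_div.comp Primrec.snd (Primrec.const 2)))))
      (Primrec.list_getElem?.comp (Primrec.snd.comp Primrec.fst) Primrec.snd)
  refine ⟨fun u => bif u.getD (2 * idx u) false then
    machineWord (idx u) (collect (input (idx u)) u) else [], ?_, fun n p q y hy => ?_⟩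
  · exact Primrec.cond ((Primrec.list_getD false).comp Primrec.id (Primrec.nat_double.comp hidx))
      (machineWord_primrec.comp hidx ((collect_primrec hinput).comp hidx Primrec.id))
      (Primrec.const [])
  have hin : Tracks (collect (input n)) (Cantor.pair (Cantor.tag n p) q) (Cantor.pair p q) := by
    refine tracks_collect (fun m k c hc => ?_) fun k => ?_
    · simp only [input] at hc
      rcases Nat.mod_two_eq_zero_or_one k with hk | hk
      · rw [if_pos hk] at hc
        rw [(Cantor.getElem?_take_eq_some hc).2, Cantor.pair_even, Cantor.tag_add]
        conv_rhs => rw [show k = 2 * (k / 2) by omega, Cantor.pair_even]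
      · rw [if_neg (by omega)] at hc
        rw [(Cantor.getElem?_take_eq_some hc).2, show k = 2 * (k / 2) + 1 by omega,
          Cantor.pair_odd, Cantor.pair_odd]
    · filter_upwards [eventually_gt_atTop (2 * (n + 1 + k / 2)), eventually_gt_atTop k]
        with m h1 h2
      simp only [input, Cantor.take_getElem? _ h1, Cantor.take_getElem? _ h2]
      split_ifs <;> rfl
  set u : Cantor := Cantor.pair (Cantor.tag n p) q with hu
  have hgetD : ∀ m i, (u.take m).getD (2 * i) false = true →
      2 * i < m ∧ Cantor.tag n p i = true := by
    intro m i h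
    rw [List.getD_eq_getElem?_getD] at h
    obtain ⟨b, hb⟩ : ∃ b, (u.take m)[2 * i]? = some b := by
      cases hb : (u.take m)[2 * i]? with
      | none => simp [hb] at h
      | some b => exact ⟨b, rfl⟩
    obtain ⟨hlt, hub⟩ := Cantor.getElem?_take_eq_some hb
    rw [hb, hub, hu, Cantor.pair_even] at h
    exact ⟨hlt, h⟩
  have hgetD' : ∀ m i, 2 * i < m → (u.take m).getD (2 * i) false = Cantor.tag n p i := by
    intro m i h
    rw [List.getD_eq_getElem?_getD, Cantor.take_getElem? _ h, hu, Cantor.pair_even]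
    rfl
  have hidx_n : ∀ m, 2 * n < m → idx (u.take m) = n := by
    intro m hm
    have hlt : n < (List.range (u.take m).length).length := by simp; omega
    simp only [idx]
    rw [List.findIdx_eq hlt]
    simp only [List.getElem_range, hgetD' m n hm, Cantor.tag_self, true_and]
    intro i hi
    rw [hgetD' m i (by omega), Cantor.tag_lt _ hi]
  -- Before the end of the tag is read the output is empty; afterwards the index is correct and the
  -- simulation runs.
  refine ((tracks_machineWord hy).comp hin).of_eventually (fun m => ?_) ?_
  · cases hb : (u.take m).getD (2 * idx (u.take m)) false with
    | false => left; rfl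
    | true =>
      right
      obtain ⟨h1, h2⟩ := hgetD _ _ hb
      have hn : idx (u.take m) = n := by
        by_cases hm : 2 * n < m
        · exact hidx_n m hm
        · by_contra hne
          rw [Cantor.tag_lt _ (by omega)] at h2
          cases h2
      simp only [hn, cond_true, Function.comp_apply]
  · filter_upwards [eventually_gt_atTop (2 * n)] with m hm
    simp only [hidx_n m hm, hgetD' m n hm, Cantor.tag_self, cond_true, Function.comp_apply]

namespace RepresentedSpace

/-! ### Computability with respect to naming relations -/

/-- The names of the elements of a product. -/
def ProdNames {α β : Type*} (M : Cantor → α → Prop) (N : Cantor → β → Prop) (r : Cantor)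
    (x : α × β) : Prop :=
  ∃ p q, r = Cantor.pair p q ∧ M p x.1 ∧ N q x.2

/-- `f` is computable with respect to the naming relations `M` and `N`. -/
def Comp {α β : Type*} (M : Cantor → α → Prop) (N : Cantor → β → Prop) (f : α → β) : Prop :=
  ∃ h, Primrec h ∧ ∀ p x, M p x → ∃ q, Tracks h p q ∧ N q (f x)

namespace Comp

variable {α β γ : Type*} {K : Cantor → γ → Prop}
  {M : Cantor → α → Prop} {N : Cantor → β → Prop}

theorem of_names {f : α → β} (h : ∀ p x, M p x → N p (f x)) : Comp M N f :=
  ⟨_root_.id, Primrec.id, fun p x hp => ⟨p, Tracks.id p, h p x hp⟩⟩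

theorem comp {g : β → γ} {f : α → β} (hg : Comp N K g) (hf : Comp M N f) :
    Comp M K fun x => g (f x) := by
  obtain ⟨b, hb, hg⟩ := hg
  obtain ⟨a, ha, hf⟩ := hf
  refine ⟨b ∘ a, hb.comp ha, fun p x hp => ?_⟩
  obtain ⟨q, hq, hq'⟩ := hf p x hp
  obtain ⟨r, hr, hr'⟩ := hg q _ hq'
  exact ⟨r, hr.comp hq, hr'⟩

theorem fst : Comp (ProdNames M N) M Prod.fst := by
  obtain ⟨h, hh, H⟩ := exists_tracks_fst
  refine ⟨h, hh, ?_⟩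
  rintro _ x ⟨p, q, rfl, hp, -⟩
  exact ⟨p, H p q, hp⟩

theorem snd : Comp (ProdNames M N) N Prod.snd := by
  obtain ⟨h, hh, H⟩ := exists_tracks_snd
  refine ⟨h, hh, ?_⟩
  rintro _ x ⟨p, q, rfl, -, hq⟩
  exact ⟨q, H p q, hq⟩

theorem pair {f : γ → α} {g : γ → β} (hf : Comp K M f) (hg : Comp K N g) :
    Comp K (ProdNames M N) fun x => (f x, g x) := by
  obtain ⟨a, ha, hf⟩ := hf
  obtain ⟨b, hb, hg⟩ := hg
  obtain ⟨c, hc, H⟩ := exists_tracks_pair ha hb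
  refine ⟨c, hc, fun p x hp => ?_⟩
  obtain ⟨q, hq, hq'⟩ := hf p x hp
  obtain ⟨r, hr, hr'⟩ := hg p x hp
  exact ⟨_, H p q r hq hr, q, r, rfl, hq', hr'⟩

variable {X : RepresentedSpace.{u}} {Y : RepresentedSpace.{v}}

/-- The s-m-n theorem: one machine `n` works for all parameters, and the name `p` of the parameter
serves as its oracle, so that `0ⁿ 1 p` is the required name. -/
theorem curry {f : α → X → Y} (hf : Comp (ProdNames M X.Names) Y.Names fun a => f a.1 a.2) :
    Comp M (FunName X Y) f := by
  obtain ⟨h, hh, hf⟩ := hf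
  obtain ⟨n, hn⟩ := exists_machine_of_tracks hh
  obtain ⟨t, ht, H⟩ := exists_tracks_tag n
  refine ⟨t, ht, fun p x hp => ⟨_, H p, n, p, rfl, fun q y hq => ?_⟩⟩
  obtain ⟨r, hr, hr'⟩ := hf _ (x, y) ⟨p, q, rfl, hp, hq⟩
  exact ⟨r, hn _ _ hr, hr'⟩

/-- This is the universal machine, applied to a pair of a function name and an argument name. -/
theorem eval : Comp (ProdNames (FunName X Y) X.Names) Y.Names fun a => a.1 a.2 := by
  obtain ⟨h, hh, H⟩ := exists_tracks_universal
  refine ⟨h, hh, ?_⟩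
  rintro _ ⟨f, x⟩ ⟨_, q, rfl, ⟨n, p, rfl, hf⟩, hq⟩
  obtain ⟨y, hy, hy'⟩ := hf q x hq
  exact ⟨y, H n p q y hy, hy'⟩

theorem apply {f : α → X → Y} {g : α → X} (hf : Comp M (FunName X Y) f) (hg : Comp M X.Names g) :
    Comp M Y.Names fun a => f a (g a) :=
  eval.comp (hf.pair hg)

theorem exists_name {f : X → β} (hf : Comp X.Names N f) (x : X) : ∃ r, N r (f x) := by
  obtain ⟨p, hp⟩ := X.surj x
  obtain ⟨h, -, hf⟩ := hf
  obtain ⟨q, -, hq⟩ := hf p x hp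
  exact ⟨q, hq⟩

end Comp

/-! ### Admissibility in terms of `Comp` -/

/-- The names of `κ(z)`, considered as names of `z`. -/
def KappaNames (Z : RepresentedSpace.{u}) (p : Cantor) (z : Z) : Prop :=
  (opens (opens Z)).Names p (kappa Z z)

/-- A preimage under `κ` can be chosen arbitrarily: `F` is single-valued, so two points with the
same image under `κ` share a name after translation by `F` and coincide. Hence a left-inverse never
has to be constructed, only a translation of names. -/
theorem exists_leftInverse {Z : RepresentedSpace.{u}} {F : Cantor →. Cantor}
    (hF : ∀ p z, KappaNames Z p z → ∃ q ∈ F p, Z.Names q z) :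
    ∃ g : kappaSpace Z → Z, Realizes (kappaSpace Z) Z F g ∧
      Function.LeftInverse g (toKappaSpace Z) := by
  refine ⟨fun φ => φ.2.choose, fun p φ hp => hF p _ ?_, fun z => ?_⟩
  · show (opens (opens Z)).Names p _
    rw [φ.2.choose_spec]
    exact hp
  · have hz : kappa Z (toKappaSpace Z z).2.choose = kappa Z z := (toKappaSpace Z z).2.choose_spec
    obtain ⟨p, hp⟩ := (opens (opens Z)).surj (kappa Z z)
    obtain ⟨q, hq, hq'⟩ := hF p z hp
    obtain ⟨r, hr, hr'⟩ := hF p (toKappaSpace Z z).2.choose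
      (show (opens (opens Z)).Names p _ by rw [hz]; exact hp)
    obtain rfl := Part.mem_unique hq hr
    exact Z.unique hr' hq'

theorem isComputablyAdmissible_iff {Z : RepresentedSpace.{u}} :
    Z.IsComputablyAdmissible ↔ Comp (KappaNames Z) Z.Names id := by
  constructor
  · rintro ⟨g, ⟨n, hn⟩, hg⟩
    refine ⟨machineWord n, machineWord_primrec.comp (Primrec.const n) Primrec.id,
      fun p z hp => ?_⟩
    obtain ⟨q, hq, hq'⟩ := hn p (toKappaSpace Z z) hp
    rw [hg z] at hq'
    exact ⟨q, tracks_machineWord hq, hq'⟩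
  · rintro ⟨h, hh, H⟩
    obtain ⟨n, hn⟩ := exists_machine_of_tracks hh
    obtain ⟨g, hg, hg'⟩ := exists_leftInverse (F := machineFun n) fun p z hp => by
      obtain ⟨q, hq, hq'⟩ := H p z hp
      exact ⟨q, hn p q hq, hq'⟩
    exact ⟨g, ⟨n, hg⟩, hg'⟩

/-- Each output symbol depends on finitely many input symbols, hence is locally constant on the
domain. -/
theorem continuous_asSubtype_machineFun_pair (n : ℕ) (o : Cantor) :
    Continuous (PFun.asSubtype fun q => machineFun n (Cantor.pair o q)) := by
  refine continuous_pi fun k => (IsLocallyConstant.iff_exists_open _).2 (fun x => ?_) |>.continuous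
  obtain ⟨q, hq⟩ := x
  obtain ⟨M, hM⟩ := machineBit_local (mem_machineFun.1 (Part.get_mem hq) k)
  refine ⟨Subtype.val ⁻¹' ⋂ i ∈ Finset.range M, (fun q' : Cantor => q' i) ⁻¹' {q i},
    IsOpen.preimage continuous_subtype_val (isOpen_biInter_finset fun i _ =>
      (isOpen_discrete _).preimage (continuous_apply i)), Set.mem_iInter₂.2 fun _ _ => rfl, ?_⟩
  rintro ⟨q', hq'⟩ hx
  refine Part.mem_unique (mem_machineFun.1 (Part.get_mem hq') k) (hM _ fun i hi => ?_)
  simp only [Cantor.pair]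
  split_ifs
  · rfl
  · exact Set.mem_iInter₂.1 hx (i / 2) (Finset.mem_range.2 (by omega))

/-- Continuity is computability relative to an oracle. The oracle `o` enters as the only name of the
parameter in `Unit`, so that closure properties of `Comp` apply unchanged. -/
theorem isAdmissible_iff {Z : RepresentedSpace.{u}} :
    Z.IsAdmissible ↔ ∃ o : Cantor,
      Comp (ProdNames (fun p (_ : Unit) => p = o) (KappaNames Z)) Z.Names Prod.snd := by
  constructor
  · rintro ⟨g, ⟨F, hF, hgF⟩, hg⟩
    obtain ⟨n, o, hn⟩ := exists_oracle_machine F (local_of_continuous hF)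
    refine ⟨o, machineWord n, machineWord_primrec.comp (Primrec.const n) Primrec.id, ?_⟩
    rintro _ ⟨_, z⟩ ⟨_, p, rfl, rfl, hp⟩
    obtain ⟨q, hq, hq'⟩ := hgF p (toKappaSpace Z z) hp
    rw [hg z] at hq'
    exact ⟨q, tracks_machineWord (hn p q hq), hq'⟩
  · rintro ⟨o, h, hh, H⟩
    obtain ⟨n, hn⟩ := exists_machine_of_tracks hh
    obtain ⟨g, hg, hg'⟩ := exists_leftInverse
      (F := fun q => machineFun n (Cantor.pair o q)) fun p z hp => by
        obtain ⟨q, hq, hq'⟩ := H _ ((), z) ⟨o, p, rfl, rfl, hp⟩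
        exact ⟨q, hn _ q hq, hq'⟩
    exact ⟨g, ⟨_, continuous_asSubtype_machineFun_pair n o, hg⟩, hg'⟩

/-- A parameter named by every sequence carries no information; the name of the argument itself can
be supplied for it. This puts the computable case into the same parametrized form as the continuous
one. -/
theorem comp_iff_prodNames_unit {α β : Type*} {M : Cantor → α → Prop} {N : Cantor → β → Prop}
    {f : α → β} : Comp M N f ↔
      Comp (ProdNames (fun _ (_ : Unit) => True) M) N (fun a => f a.2) := by
  refine ⟨fun h => h.comp Comp.snd, fun h => ?_⟩
  have h1 : Comp M (fun _ (_ : Unit) => True) fun _ => () := Comp.of_names fun _ _ _ => trivial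
  exact h.comp (h1.pair (Comp.of_names (f := id) fun _ _ hp => hp))

theorem IsComputablyAdmissible.isAdmissible {Z : RepresentedSpace.{u}}
    (h : Z.IsComputablyAdmissible) : Z.IsAdmissible :=
  isAdmissible_iff.2 ⟨fun _ => false, (isComputablyAdmissible_iff.1 h).comp Comp.snd⟩

/-! ### Admissible spaces -/

theorem comp_kappa (X : RepresentedSpace.{u}) :
    Comp X.Names (opens (opens X)).Names (kappa X) :=
  Comp.curry (X := opens X) (Y := sierpinski) (f := fun (x : X) (U : opens X) => x ∈ U.1)
    (Comp.apply (X := X) (Y := sierpinski) (f := fun (a : X × opens X) x => x ∈ a.2.1)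
      (Comp.snd (N := (opens X).Names)) Comp.fst)

/-- For `W = κ(x)`, the conditions `W ∈ κ(U)`, `U ∈ W` and `x ∈ U` coincide, so `x ∈ U` is
semidecided by applying the name of `κ(U)` to a name of `κ(x)`. -/
theorem opens_isComputablyAdmissible (X : RepresentedSpace.{u}) :
    X.opens.IsComputablyAdmissible := by
  rw [isComputablyAdmissible_iff]
  refine Comp.curry (X := X) (Y := sierpinski) (f := fun (U : opens X) (x : X) => x ∈ U.1) ?_
  exact Comp.apply (X := opens (opens X)) (Y := sierpinski)
    (f := fun (a : opens X × X) (W : opens (opens X)) => a.1 ∈ W.1) (g := fun a => kappa X a.2)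
    (Comp.fst (M := KappaNames (opens X))) ((comp_kappa X).comp Comp.snd)

/-- A realizer of the characteristic map of `V` on `Y` is also one for its preimage under `i`, so
`pre` leaves names unchanged. As `i x ∈ V` iff `pre V` belongs to `κ(x)`, one obtains `κ(i x)`, then
a name of `i x`, and this is a name of `x`. -/
theorem isComputablyAdmissible_of_embedding {X : RepresentedSpace.{u}} {Y : RepresentedSpace.{v}}
    (i : X → Y) (hi : ∀ p x, X.Names p x ↔ Y.Names p (i x)) (hY : Y.IsComputablyAdmissible) :
    X.IsComputablyAdmissible := by
  rw [isComputablyAdmissible_iff] at hY ⊢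
  have hpre : ∀ r (V : opens Y), (opens Y).Names r V →
      FunName X sierpinski r fun x => i x ∈ V.1 := by
    rintro r V ⟨n, p, rfl, h⟩
    exact ⟨n, p, rfl, fun q x hx => h q (i x) ((hi q x).1 hx)⟩
  let pre : opens Y → opens X := fun V => ⟨{x | i x ∈ V.1}, (V.2.imp fun r hr => hpre r V hr)⟩
  have hκ : Comp (KappaNames X) (KappaNames Y) i :=
    Comp.curry (X := opens Y) (Y := sierpinski) (f := fun (x : X) (V : opens Y) => i x ∈ V.1)
      (Comp.apply (X := opens X) (Y := sierpinski)
        (f := fun (a : X × opens Y) (U : opens X) => a.1 ∈ U.1) (g := fun a => pre a.2)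
        (Comp.fst (M := KappaNames X)) (Comp.of_names (f := pre) (hpre · ·) |>.comp Comp.snd))
  obtain ⟨h, hh, H⟩ := hY.comp hκ
  refine ⟨h, hh, fun p x hp => ?_⟩
  obtain ⟨q, hq, hq'⟩ := H p x hp
  exact ⟨q, hq, (hi q x).2 hq'⟩

/-- The parameter with naming relation `A` is an oracle or nothing, so both claims about `𝒞(X, Y)`
are instances. -/
theorem funSpace_comp {α : Type*} {A : Cantor → α → Prop} {X : RepresentedSpace.{u}}
    {Y : RepresentedSpace.{v}} (hY : Comp (ProdNames A (KappaNames Y)) Y.Names Prod.snd) :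
    Comp (ProdNames A (KappaNames (funSpace X Y))) (funSpace X Y).Names Prod.snd := by
  -- The product is needed as a represented space so that `Comp.exists_name` shows each set in the
  -- family `W` to be open.
  let S : RepresentedSpace := ⟨X × opens Y, ProdNames X.Names (opens Y).Names, by
    rintro _ x y ⟨p, q, rfl, hp, hq⟩ ⟨p', q', e, hp', hq'⟩
    obtain ⟨rfl, rfl⟩ := Cantor.pair_inj e
    exact Prod.ext (X.unique hp hp') ((opens Y).unique hq hq'), fun x => by
    obtain ⟨p, hp⟩ := X.surj x.1
    obtain ⟨q, hq⟩ := (opens Y).surj x.2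
    exact ⟨_, p, q, rfl, hp, hq⟩⟩
  have hW : Comp S.Names (FunName (funSpace X Y) sierpinski)
      (fun (a : X × opens Y) (f : funSpace X Y) => f.1 a.1 ∈ a.2.1) :=
    Comp.curry (Comp.apply (X := Y) (Y := sierpinski)
      (f := fun (a : (X × opens Y) × funSpace X Y) y => y ∈ a.1.2.1)
      ((Comp.snd (N := (opens Y).Names)).comp Comp.fst)
      (Comp.apply (X := X) (Y := Y) (f := fun (a : (X × opens Y) × funSpace X Y) => a.2.1)
        (Comp.snd (N := (funSpace X Y).Names)) (Comp.fst.comp Comp.fst)))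
  let W : X × opens Y → opens (funSpace X Y) := fun a =>
    ⟨{f | f.1 a.1 ∈ a.2.1}, Comp.exists_name (X := S) hW a⟩
  have hW' : Comp (ProdNames X.Names (opens Y).Names) (opens (funSpace X Y)).Names W := hW
  -- Passes from `κ(f)` and `x` to `κ(f x)`: the question whether `f x ∈ V` becomes whether `W (x,
  -- V)` belongs to `κ(f)`.
  have hκ : Comp (ProdNames (KappaNames (funSpace X Y)) X.Names) (KappaNames Y)
      fun a => a.1.1 a.2 :=
    Comp.curry (X := opens Y) (Y := sierpinski)
      (f := fun (a : funSpace X Y × X) (V : opens Y) => a.1.1 a.2 ∈ V.1)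
      (Comp.apply (X := opens (funSpace X Y)) (Y := sierpinski)
        (f := fun (a : (funSpace X Y × X) × opens Y) (U : opens (funSpace X Y)) => a.1.1 ∈ U.1)
        (g := fun a => W (a.1.2, a.2))
        ((Comp.fst (M := KappaNames (funSpace X Y))).comp Comp.fst)
        (hW'.comp ((Comp.snd.comp Comp.fst).pair Comp.snd)))
  exact Comp.curry (X := X) (Y := Y) (f := fun a : α × funSpace X Y => a.2.1)
    (hY.comp ((Comp.fst.comp Comp.fst).pair (hκ.comp ((Comp.snd.comp Comp.fst).pair Comp.snd))))

/-! ### Spaces whose names are those of points of `𝒪(X)` or `𝒪(𝒪(X))`, and the function space. -/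

theorem closeds_isComputablyAdmissible (X : RepresentedSpace.{u}) :
    X.closeds.IsComputablyAdmissible :=
  isComputablyAdmissible_of_embedding (Y := opens X) (fun A => ⟨{x | x ∉ A.1}, A.2⟩)
    (fun _ _ => Iff.rfl) (opens_isComputablyAdmissible X)

theorem kappaSpace_isComputablyAdmissible (X : RepresentedSpace.{u}) :
    X.kappaSpace.IsComputablyAdmissible :=
  isComputablyAdmissible_of_embedding (Y := opens (opens X)) Subtype.val
    (fun _ _ => Iff.rfl) (opens_isComputablyAdmissible _)

theorem compacts_isComputablyAdmissible (X : RepresentedSpace.{u}) :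
    X.compacts.IsComputablyAdmissible :=
  isComputablyAdmissible_of_embedding (Y := opens (opens X))
    (fun K => ⟨{U | K.1 ⊆ U.1}, (compacts X).surj K⟩)
    (fun _ _ => Iff.rfl) (opens_isComputablyAdmissible _)

theorem overts_isComputablyAdmissible (X : RepresentedSpace.{u}) :
    X.overts.IsComputablyAdmissible :=
  isComputablyAdmissible_of_embedding (Y := opens (opens X))
    (fun C => ⟨{U | (U.1 ∩ C.1).Nonempty}, (overts X).surj C⟩)
    (fun _ _ => Iff.rfl) (opens_isComputablyAdmissible _)

theorem IsAdmissible.funSpace (X : RepresentedSpace.{u}) {Y : RepresentedSpace.{v}}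
    (hY : Y.IsAdmissible) : (funSpace X Y).IsAdmissible := by
  obtain ⟨o, ho⟩ := isAdmissible_iff.1 hY
  exact isAdmissible_iff.2 ⟨o, funSpace_comp ho⟩

theorem IsComputablyAdmissible.funSpace (X : RepresentedSpace.{u}) {Y : RepresentedSpace.{v}}
    (hY : Y.IsComputablyAdmissible) : (funSpace X Y).IsComputablyAdmissible :=
  isComputablyAdmissible_iff.2 <| comp_iff_prodNames_unit.2 <|
    funSpace_comp (comp_iff_prodNames_unit.1 (isComputablyAdmissible_iff.1 hY))

end RepresentedSpace

theorem theorem30 (X : RepresentedSpace.{u}) (Y : RepresentedSpace.{v}) :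
    ((Y.IsAdmissible → (RepresentedSpace.funSpace X Y).IsAdmissible) ∧
      (Y.IsComputablyAdmissible → (RepresentedSpace.funSpace X Y).IsComputablyAdmissible)) ∧
    (X.kappaSpace.IsAdmissible ∧ X.kappaSpace.IsComputablyAdmissible) ∧
    (X.opens.IsAdmissible ∧ X.opens.IsComputablyAdmissible) ∧
    (X.closeds.IsAdmissible ∧ X.closeds.IsComputablyAdmissible) ∧
    (X.compacts.IsAdmissible ∧ X.compacts.IsComputablyAdmissible) ∧
    (X.overts.IsAdmissible ∧ X.overts.IsComputablyAdmissible) := by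
  have h {Z : RepresentedSpace.{u}} (hZ : Z.IsComputablyAdmissible) :
      Z.IsAdmissible ∧ Z.IsComputablyAdmissible := ⟨hZ.isAdmissible, hZ⟩
  exact ⟨⟨.funSpace X, .funSpace X⟩, h (RepresentedSpace.kappaSpace_isComputablyAdmissible X),
    h (RepresentedSpace.opens_isComputablyAdmissible X),
    h (RepresentedSpace.closeds_isComputablyAdmissible X),
    h (RepresentedSpace.compacts_isComputablyAdmissible X),
    h (RepresentedSpace.overts_isComputablyAdmissible X)⟩
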